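/- Let $p$ be an odd prime, $n\ge 1$ and $q=p^n$ with $q\equiv 3\pmod 4$. Let $\chi$ be the quadratic character of $\mathbb{F}_q$ (with $\chi(0)=0$), and for an integer $r\ge 1$ let $F_r(x)=x^r(1+\chi(x))$ on $\mathbb{F}_q$. For $b\in\mathbb{F}_q$ let $D_{00}(b)$ be the number of $x\in\mathbb{F}_q$ with $\chi(x)=\chi(x+1)=1$ and $F_r(x+1)-F_r(x)=b$. The boomerang uniformity of a function $f:\mathbb{F}_q\to\mathbb{F}_q$ is $$\beta_f=\max_{a,b\in\mathbb{F}_q^*}\#\{(x,y)\in\mathbb{F}_q^2 : f(x)-f(y)=b,\ f(x+a)-f(y+a)=b\}.$$ **Theorem.** If $D_{00}(b)\le 1$ for all $b\in\mathbb{F}_q^*$ and $\gcd(r,q-1)\mid 2$, then $\beta_{F_r}\le 2$. In particular, $\beta_{F_r}\le 2$ in each of the following cases: 1. $r=p^k+1$ with an integer $k\ge 0$, and $n$ is odd; 2. $r=\frac{3^k+1}{2}$ with an integer $k\ge 0$ such that $\gcd(k,n)=1$, where $p=3$ and $n$ is odd; 3. $r=3$ and $q\equiv 11\pmod{12}$;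 4. $r=\frac{2q-1}{3}$ and $q\equiv 11\pmod{12}$; 5. $r=\frac{3^{(n+1)/2}-1}{2}$, where $p=3$ and $n$ is odd; 6. $r=\frac{3^{n+1}-1}{8}$, where $p=3$ and $n$ is odd. -/

import Mathlib

namespace Boomerang

section Functions

variable {F : Type*} [Field F] [Fintype F] [DecidableEq F]

/-- The function `F_r(x) = x ^ r * (1 + χ(x))`, with `χ` the quadratic character of `F`. -/
def Fr (r : ℕ) (x : F) : F := x ^ r * (1 + ((quadraticChar F x : ℤ) : F))

/-- `S_{ij}`: the `x` with `χ(x) = (-1)^i` and `χ(x+1) = (-1)^j`. -/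
def S (F : Type*) [Field F] [Fintype F] [DecidableEq F] (i j : ℕ) : Finset F :=
  {x : F | quadraticChar F x = (-1) ^ i ∧ quadraticChar F (x + 1) = (-1) ^ j}

/-- `D_{ij}(b)`: the number of solutions `x ∈ S_{ij}` of `F_r(x+1) - F_r(x) = b`. -/
def D (r i j : ℕ) (b : F) : ℕ :=
  ((S F i j).filter (fun x => Fr r (x + 1) - Fr r x = b)).card

/-- `β_f(a,b)`: the number of pairs `(x, y)` with
`f(x) - f(y) = b` and `f(x+a) - f(y+a) = b`. -/
def boomerangCount (f : F → F) (a b : F) : ℕ :=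
  ((Finset.univ : Finset (F × F)).filter
    (fun z => f z.1 - f z.2 = b ∧ f (z.1 + a) - f (z.2 + a) = b)).card

/-- The boomerang uniformity `β_f`: the maximum of `β_f(a,b)` over all nonzero `a` and `b`. -/
def boomerangUniformity (f : F → F) : ℕ :=
  ((Finset.univ : Finset (F × F)).filter (fun z => z.1 ≠ 0 ∧ z.2 ≠ 0)).sup
    (fun z => boomerangCount f z.1 z.2)

end Functions

/-- The listed exponents `r`, for `q = p ^ n`. Each quotient `r = s / m` of the list is written
as `m * r = s`; all these quotients are exact. -/
def IsListedExponent (p n r : ℕ) : Prop :=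
  -- r = p^k + 1, n odd
  (Odd n ∧ ∃ k : ℕ, r = p ^ k + 1) ∨
  -- r = (3^k + 1) / 2, p = 3, n odd, gcd(k, n) = 1
  (p = 3 ∧ Odd n ∧ ∃ k : ℕ, Nat.gcd k n = 1 ∧ 2 * r = 3 ^ k + 1) ∨
  -- r = 3, q ≡ 11 (mod 12)
  (p ^ n % 12 = 11 ∧ r = 3) ∨
  -- r = (2q - 1) / 3, q ≡ 11 (mod 12)
  (p ^ n % 12 = 11 ∧ 3 * r = 2 * p ^ n - 1) ∨
  -- r = (3^((n+1)/2) - 1) / 2, p = 3, n odd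
  (p = 3 ∧ Odd n ∧ 2 * r = 3 ^ ((n + 1) / 2) - 1) ∨
  -- r = (3^(n+1) - 1) / 8, p = 3, n odd
  (p = 3 ∧ Odd n ∧ 8 * r = 3 ^ (n + 1) - 1)

end Boomerang

/-!
The function `F_r` equals `2 x ^ r` on the nonzero squares and vanishes elsewhere. As
`q ≡ 3 (mod 4)`, exactly one of `x`, `-x` is a nonzero square, so symmetries reduce the boomerang
system to shift `a = 1` and `b / 2` a nonzero square. Then `F_r(x) - F_r(y) = b` forces `x` to be a
nonzero square, and likewise `x + 1`. Since `gcd(r, q - 1) ∣ 2` makes `x ↦ x ^ r` injective on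
the nonzero squares, there is at most one solution with `y` outside the nonzero squares (`x` is the
`r`-th root of `b / 2`) and at most one with `y + 1` outside them. If `y` and `y + 1` are both
nonzero squares, `x` and `y` give the same value of `F_r(x + 1) - F_r(x)`, and `D₀₀ ≤ 1` yields
`x = y`, against `b ≠ 0`. This is `boomerangCount_one_le` and `boomerangUniformity_Fr_le_two`.

For each listed exponent it remains to see that `(x + 1) ^ r - x ^ r` determines `x` when `x` and
`x + 1` are nonzero squares. For most of them this is a short computation in which two solutions
would make `-1` a square. In characteristic `3` the pairs `x`, `x + 1` are parametrized by
`x = (t - t⁻¹) ^ 2`, `x + 1 = (t + t⁻¹) ^ 2`.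

The exponent `r = (Q - 1) / 2` with `Q = 3 ^ ((n + 1) / 2)` is the hard one. With `ρ = t ^ (Q - 1)`,
`P = ρ + ρ⁻¹`, `M = ρ - ρ⁻¹` and `B = -b⁻¹` the equation becomes `B M = P φ(M) + M φ(P)` for the
`Q`-power map `φ`, whose square is cubing because `Q ^ 2 = 3 q`. Applying `φ` and eliminating gives
a cubic for `P`. From two of its roots that solve the original equation one gets an element `ε` with
`φ (ε + B φ(B)) = ε` and `φ(ε) = (ε - B φ(B)) ^ 3`; since `φ ∘ φ` is cubing, `B φ(B) = 0`, a
contradiction (`eq_of_conic_equation`).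
-/

namespace Boomerang

/-! ### An equation on the conic `P ^ 2 - M ^ 2 = 1` in characteristic three -/

section Conic

variable {F : Type*} [Field F]

/-- Here `p'`, `m'`, `B'` stand for the images of `P`, `M`, `B` under the `Q`-power map `φ`. The
hypothesis `hB'` is the image of `hB`, and both are linear in `p'` and `m'`. Solving them gives the
first two relations, and substituting these in `p' ^ 2 - m' ^ 2 = 1` gives a cubic equation for `P`
with coefficients in `B` and `B'`. -/
theorem conic_relations (h3 : (3 : F) = 0) {P M p' m' B B' : F} (hM : M ≠ 0)
    (hPM : P ^ 2 - M ^ 2 = 1) (hB : B * M = P * m' + M * p')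
    (hB' : B' * m' = P ^ 3 * m' + M ^ 3 * p') (hpm : p' ^ 2 - m' ^ 2 = 1) :
    p' * (B' - P) = B * (B' - P ^ 3) ∧ m' * (B' - P) = B * M ^ 3 ∧
      B ^ 2 * (B' ^ 2 + B' * P ^ 3 + 1) = (B' - P) ^ 2 := by
  have h1 : p' * (B' - P) = B * (B' - P ^ 3) := by
    apply mul_left_cancel₀ hM
    linear_combination (P ^ 3 - B') * hB - P * hB' + M * p' * P * hPM
  have h2 : m' * (B' - P) = B * M ^ 3 := by
    linear_combination hB' - M ^ 2 * hB + P * m' * hPM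
  refine ⟨h1, h2, ?_⟩
  have hM6 : M ^ 6 = P ^ 6 - 1 := by
    have : M ^ 2 = P ^ 2 - 1 := by linear_combination -hPM
    calc M ^ 6 = (M ^ 2) ^ 3 := by ring
      _ = (P ^ 2 - 1) ^ 3 := by rw [this]
      _ = P ^ 6 - 1 := by linear_combination (-P ^ 4 + P ^ 2) * h3
  linear_combination (B' - P) ^ 2 * hpm - (p' * (B' - P) + B * (B' - P ^ 3)) * h1
    + (m' * (B' - P) + B * M ^ 3) * h2 + B ^ 2 * hM6 + B ^ 2 * B' * P ^ 3 * h3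

/-- Take two solutions `P₁ ≠ P₂` with difference `e`, ordered so that `hs` holds, and put `ε = K e`,
where `K = B ^ 2 * φ B`. Then `φ (ε + B * φ B) = ε` and `φ ε = (ε - B * φ B) ^ 3`. As
`φ (φ a) = a ^ 3`, the cubes of `ε + B * φ B` and `ε - B * φ B` agree, which forces `B = 0`. -/
theorem false_of_two_conic_solutions (h3 : (3 : F) = 0) (φ : F →+* F) (hφ : ∀ a, φ (φ a) = a ^ 3)
    {B K e ε P₁ P₂ : F} (hB0 : B ≠ 0) (he : P₁ - P₂ = e) (he0 : e ≠ 0)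
    (hK : K = B ^ 2 * φ B) (hε : ε = K * e)
    (h1 : φ P₁ * (φ B - P₁) = B * (φ B - P₁ ^ 3)) (h2 : φ P₂ * (φ B - P₂) = B * (φ B - P₂ ^ 3))
    (hd1 : φ B - P₁ = e * (ε + 1)) (hd2 : φ B - P₂ = e * (ε - 1))
    (hn : ε ^ 2 - 1 ≠ 0)
    (hs : ε * (ε ^ 2 - 1) = K * B * ((φ B) ^ 2 - 1)) : False := by
  have hB'0 : φ B ≠ 0 := by simpa using hB0
  have hK0 : K ≠ 0 := by rw [hK]; positivity
  have hP1 : P₁ = φ B - e * (ε + 1) := by linear_combination -hd1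
  have hP2 : P₂ = φ B - e * (ε - 1) := by linear_combination -hd2
  have he' : φ e = φ P₁ - φ P₂ := by rw [← he, map_sub]
  have key : B ^ 2 * φ e = K * (B ^ 3 * e ^ 3 - 1) := by
    apply mul_left_cancel₀ (mul_ne_zero he0 hn)
    have hc1 : φ B - P₁ ^ 3 = φ B - φ B ^ 3 + e ^ 3 * (ε + 1) ^ 3 := by
      rw [hP1]
      linear_combination (φ B ^ 2 * (e * (ε + 1)) - φ B * (e * (ε + 1)) ^ 2) * h3
    have hc2 : φ B - P₂ ^ 3 = φ B - φ B ^ 3 + e ^ 3 * (ε - 1) ^ 3 := by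
      rw [hP2]
      linear_combination (φ B ^ 2 * (e * (ε - 1)) - φ B * (e * (ε - 1)) ^ 2) * h3
    rw [hc1, hd1] at h1
    rw [hc2, hd2] at h2
    rw [he']
    have hs' : ε * (ε ^ 2 - 1) = B ^ 3 * (φ B ^ 3 - φ B) := by rw [hs, hK]; ring
    linear_combination B ^ 2 * (ε - 1) * h1 - B ^ 2 * (ε + 1) * h2 + hs'
      + (ε ^ 2 - 1) * (B ^ 3 * e ^ 3 - 1) * hε
      + B ^ 3 * (φ B ^ 3 - φ B + e ^ 3 * ε * (ε ^ 2 - 1)) * h3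
  have hφε : φ ε = (ε - B * φ B) ^ 3 := by
    have hφK : φ K = φ B ^ 2 * B ^ 3 := by rw [hK, map_mul, map_pow, hφ]
    have hε3 : ε ^ 3 = (B ^ 2 * φ B * e) ^ 3 := by rw [hε, hK]
    calc φ ε = φ B ^ 2 * B * (B ^ 2 * φ e) := by rw [hε, map_mul, hφK]; ring
      _ = ε ^ 3 - (B * φ B) ^ 3 := by rw [key, hε3, hK]; ring
      _ = (ε - B * φ B) ^ 3 := by
        linear_combination (ε ^ 2 * (B * φ B) - ε * (B * φ B) ^ 2) * h3
  have hφsum : φ (ε + B * φ B) = ε := by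
    rw [map_add, map_mul, hφ, hφε]
    rw [hK] at hs
    linear_combination hs - (ε ^ 2 * (B * φ B) - ε * (B * φ B) ^ 2) * h3
  have hcube : (ε + B * φ B) ^ 3 = (ε - B * φ B) ^ 3 := by rw [← hφ, hφsum, hφε]
  have : (B * φ B) ^ 3 = 0 := by
    linear_combination (2 * ε ^ 2 * (B * φ B) + (B * φ B) ^ 3) * h3 - hcube
  exact mul_ne_zero hB0 hB'0 (pow_eq_zero_iff (by norm_num) |>.1 this)

/-- For `P = ρ + ρ⁻¹`, `M = ρ - ρ⁻¹` and `φ` the `Q`-power map, `P * φ M + M * φ P` equals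
`2 * (ρ ^ (Q + 1) - ρ ^ (-(Q + 1)))`, so the equation fixes the quotient of
`ρ ^ (Q + 1) - ρ ^ (-(Q + 1))` by `ρ - ρ⁻¹`; the lemma says that this quotient determines
`ρ + ρ⁻¹`. -/
theorem eq_of_conic_equation (h3 : (3 : F) = 0) (φ : F →+* F) (hφ : ∀ a, φ (φ a) = a ^ 3)
    {B P₁ M₁ P₂ M₂ : F} (hB0 : B ≠ 0) (hM₁ : M₁ ≠ 0) (hM₂ : M₂ ≠ 0)
    (hPM₁ : P₁ ^ 2 - M₁ ^ 2 = 1) (hPM₂ : P₂ ^ 2 - M₂ ^ 2 = 1)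
    (hB₁ : B * M₁ = P₁ * φ M₁ + M₁ * φ P₁) (hB₂ : B * M₂ = P₂ * φ M₂ + M₂ * φ P₂) :
    P₁ = P₂ := by
  by_contra hne
  have rel : ∀ {P M : F}, M ≠ 0 → P ^ 2 - M ^ 2 = 1 → B * M = P * φ M + M * φ P →
      φ P * (φ B - P) = B * (φ B - P ^ 3) ∧ φ B - P ≠ 0 ∧
        B ^ 2 * (φ B ^ 2 + φ B * P ^ 3 + 1) = (φ B - P) ^ 2 := by
    intro P M hM hPM hB
    have hB' := congrArg φ hB
    have hpm := congrArg φ hPM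
    simp only [map_mul, map_add, map_sub, map_pow, map_one, hφ] at hB' hpm
    obtain ⟨h1, h2, h4⟩ := conic_relations (B' := φ B) h3 hM hPM hB (by linear_combination hB') hpm
    refine ⟨h1, fun h0 => ?_, h4⟩
    rw [h0, mul_zero] at h2
    exact mul_ne_zero hB0 (pow_ne_zero 3 hM) h2.symm
  obtain ⟨ha1, hb1, hc1⟩ := rel hM₁ hPM₁ hB₁
  obtain ⟨ha2, hb2, hc2⟩ := rel hM₂ hPM₂ hB₂
  have he0 : P₁ - P₂ ≠ 0 := sub_ne_zero.2 hne
  obtain ⟨e, he⟩ : ∃ e, e = P₁ - P₂ := ⟨_, rfl⟩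
  obtain ⟨K, hK⟩ : ∃ K, K = B ^ 2 * φ B := ⟨_, rfl⟩
  obtain ⟨ε, hε⟩ : ∃ ε, ε = K * e := ⟨_, rfl⟩
  have hsum : K * e ^ 2 = P₁ + P₂ + φ B := by
    apply mul_left_cancel₀ he0
    rw [hK, he]
    linear_combination hc1 - hc2 + (B ^ 2 * φ B * (P₁ * P₂ ^ 2 - P₁ ^ 2 * P₂)
      - (P₁ - P₂) * φ B) * h3
  have hd1 : φ B - P₁ = e * (ε + 1) := by
    rw [hε]; linear_combination -hsum - he + (-P₁) * h3
  have hd2 : φ B - P₂ = e * (ε - 1) := by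
    rw [hε]; linear_combination -hsum + he - P₂ * h3
  rw [← he] at he0
  have hn : ε ^ 2 - 1 ≠ 0 := by
    intro h
    refine mul_ne_zero hb1 hb2 ?_
    rw [hd1, hd2]; linear_combination e ^ 2 * h
  -- The cubic equation for `P₁`, rewritten in `e`, has both sides perfect squares in
  -- characteristic `3`.
  have hsq : (ε * (ε ^ 2 - 1)) ^ 2 = (K * B * (φ B ^ 2 - 1)) ^ 2 := by
    rw [hd1] at hc1
    have hP1 : P₁ = φ B - e * (ε + 1) := by linear_combination -hd1
    have hP3 : P₁ ^ 3 = φ B ^ 3 - e ^ 3 * (ε + 1) ^ 3 := by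
      rw [hP1]
      linear_combination (φ B * (e * (ε + 1)) ^ 2 - φ B ^ 2 * (e * (ε + 1))) * h3
    have hε2 : ε ^ 2 = K ^ 2 * e ^ 2 := by rw [hε]; ring
    have hε3 : ε ^ 3 = K ^ 3 * e ^ 3 := by rw [hε]; ring
    linear_combination -K ^ 2 * hc1 - K ^ 2 * P₁ ^ 3 * hK + K ^ 3 * hP3 + K ^ 2 * φ B ^ 3 * hK
      + (ε + 1) ^ 3 * hε3 + (ε + 1) ^ 2 * hε2
      + (K ^ 2 * B ^ 2 * φ B ^ 2 - ε ^ 3 * (ε + 1) ^ 2) * h3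
  -- Exchanging `P₁` and `P₂` changes the sign of `ε`.
  rcases sq_eq_sq_iff_eq_or_eq_neg.1 hsq with h | h
  · exact false_of_two_conic_solutions h3 φ hφ hB0 he.symm he0 hK hε ha1 ha2 hd1 hd2 hn h
  · refine false_of_two_conic_solutions h3 φ hφ (e := -e) (ε := -ε) hB0 (by rw [he]; ring)
      (neg_ne_zero.2 he0) hK (by rw [hε]; ring) ha2 ha1 (by rw [hd2]; ring) (by rw [hd1]; ring)
      (by simpa using hn) ?_
    linear_combination -h

end Conic

/-! ### Nonzero squares and the bound on the boomerang uniformity -/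

section Uniformity

variable {F : Type*} [Field F]

/-- The nonzero squares of `F`, i.e. the elements of quadratic character `1`. -/
def IsNonzeroSquare (x : F) : Prop := x ≠ 0 ∧ IsSquare x

theorem IsNonzeroSquare.pow {x : F} (hx : IsNonzeroSquare x) (r : ℕ) :
    IsNonzeroSquare (x ^ r) := ⟨pow_ne_zero r hx.1, hx.2.pow r⟩

theorem IsNonzeroSquare.inv {x : F} (hx : IsNonzeroSquare x) :
    IsNonzeroSquare x⁻¹ := ⟨inv_ne_zero hx.1, hx.2.inv⟩

variable [Fintype F]

theorem two_ne_zero_of_card (hq : Fintype.card F % 4 = 3) : (2 : F) ≠ 0 := by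
  apply Ring.two_ne_zero
  intro h
  have := FiniteField.even_card_iff_char_two.1 h
  omega

theorem not_isSquare_neg_one (hq : Fintype.card F % 4 = 3) : ¬ IsSquare (-1 : F) := by
  rw [FiniteField.isSquare_neg_one_iff]
  simpa using hq

theorem IsNonzeroSquare.not_neg (hq : Fintype.card F % 4 = 3) {x : F} (hx : IsNonzeroSquare x) :
    ¬ IsNonzeroSquare (-x) := by
  intro h
  apply not_isSquare_neg_one hq
  have := h.2.mul hx.inv.2
  rwa [neg_mul, mul_inv_cancel₀ hx.1] at this

/-- As `q - 1` is twice an odd number, the condition on `r` says that `r` is prime to the order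
`(q - 1) / 2` of the group of nonzero squares. -/
theorem IsNonzeroSquare.pow_inj (hq : Fintype.card F % 4 = 3) {r : ℕ}
    (hr : Nat.gcd r (Fintype.card F - 1) ∣ 2) {x y : F} (hx : IsNonzeroSquare x)
    (hy : IsNonzeroSquare y) (h : x ^ r = y ^ r) : x = y := by
  obtain ⟨hx0, u, rfl⟩ := hx
  obtain ⟨hy0, w, rfl⟩ := hy
  have hu : u ≠ 0 := left_ne_zero_of_mul hx0
  have hw : w ≠ 0 := left_ne_zero_of_mul hy0
  have h1 : (u / w) ^ (2 * r) = 1 := by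
    rw [pow_mul, div_pow, div_pow, sq, sq, h, div_self (pow_ne_zero r hy0)]
  have h2 : (u / w) ^ (Fintype.card F - 1) = 1 :=
    FiniteField.pow_card_sub_one_eq_one _ (div_ne_zero hu hw)
  have hd : orderOf (u / w) ∣ 2 := by
    have e1 := orderOf_dvd_of_pow_eq_one h1
    have e2 := orderOf_dvd_of_pow_eq_one h2
    have e3 : orderOf (u / w) ∣ 4 := by
      have : orderOf (u / w) ∣ Nat.gcd (2 * r) (2 * (Fintype.card F - 1)) :=
        Nat.dvd_gcd e1 (e2.mul_left 2)
      rw [Nat.gcd_mul_left] at this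
      exact this.trans (mul_dvd_mul_left 2 hr)
    have e4 : Nat.gcd 4 (Fintype.card F - 1) = 2 := by
      have : Fintype.card F - 1 = 4 * (Fintype.card F / 4) + 2 := by omega
      rw [this]; simp
    exact e4 ▸ Nat.dvd_gcd e3 e2
  have h3 := orderOf_dvd_iff_pow_eq_one.1 hd
  rw [div_pow, div_eq_one_iff_eq (pow_ne_zero 2 hw)] at h3
  linear_combination h3

variable [DecidableEq F]

theorem isNonzeroSquare_iff {x : F} : IsNonzeroSquare x ↔ quadraticChar F x = 1 := by
  by_cases hx : x = 0
  · simp [IsNonzeroSquare, hx]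
  · rw [IsNonzeroSquare, quadraticChar_one_iff_isSquare hx, and_iff_right hx]

theorem isNonzeroSquare_or_neg (hq : Fintype.card F % 4 = 3) {x : F} (hx : x ≠ 0) :
    IsNonzeroSquare x ∨ IsNonzeroSquare (-x) := by
  have h1 : quadraticChar F (-1) = -1 :=
    quadraticChar_neg_one_iff_not_isSquare.2 (not_isSquare_neg_one hq)
  rw [isNonzeroSquare_iff, isNonzeroSquare_iff, ← neg_one_mul, map_mul, h1]
  rcases quadraticChar_dichotomy hx with h | h <;> simp [h]

theorem Fr_of_isNonzeroSquare {x : F} (hx : IsNonzeroSquare x) (r : ℕ) :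
    Fr r x = 2 * x ^ r := by
  rw [Fr, isNonzeroSquare_iff.1 hx]
  push_cast
  ring

theorem Fr_of_not_isNonzeroSquare {x : F} (hx : ¬ IsNonzeroSquare x) {r : ℕ} (hr : 1 ≤ r) :
    Fr r x = 0 := by
  by_cases h0 : x = 0
  · simp [Fr, h0, Nat.pos_iff_ne_zero.1 hr]
  · have : quadraticChar F x = -1 := by
      rw [isNonzeroSquare_iff] at hx
      exact (quadraticChar_dichotomy h0).resolve_left hx
    simp [Fr, this]

theorem Fr_mul {c : F} (hc : IsNonzeroSquare c) (r : ℕ) (x : F) :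
    Fr r (c * x) = c ^ r * Fr r x := by
  rw [Fr, Fr, map_mul, isNonzeroSquare_iff.1 hc, one_mul]
  ring

theorem mem_S_zero_zero {x : F} : x ∈ S F 0 0 ↔ IsNonzeroSquare x ∧ IsNonzeroSquare (x + 1) := by
  simp [S, isNonzeroSquare_iff]

theorem boomerangCount_le_of_injective {f : F → F} {a b a' b' : F} (g : F × F → F × F)
    (hg : Function.Injective g)
    (h : ∀ x y, f x - f y = b → f (x + a) - f (y + a) = b →
      f (g (x, y)).1 - f (g (x, y)).2 = b' ∧ f ((g (x, y)).1 + a') - f ((g (x, y)).2 + a') = b') :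
    boomerangCount f a b ≤ boomerangCount f a' b' := by
  refine Finset.card_le_card_of_injOn g ?_ hg.injOn
  rintro ⟨x, y⟩ hz
  simp only [Finset.coe_filter, Finset.mem_univ, true_and, Set.mem_ofPred_eq] at hz ⊢
  exact h x y hz.1 hz.2

theorem isNonzeroSquare_of_sub_eq (hq : Fintype.card F % 4 = 3) {r : ℕ} (hr : 1 ≤ r) {b x y : F}
    (hb : IsNonzeroSquare (b / 2)) (h : Fr r x - Fr r y = b) : IsNonzeroSquare x := by
  have h2 := two_ne_zero_of_card hq
  have hb0 : b ≠ 0 := (div_ne_zero_iff.1 hb.1).1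
  by_contra hx
  rw [Fr_of_not_isNonzeroSquare hx hr, zero_sub] at h
  by_cases hy : IsNonzeroSquare y
  · rw [Fr_of_isNonzeroSquare hy] at h
    apply (hy.pow r).not_neg hq
    have : -y ^ r = b / 2 := by rw [← h]; field_simp
    rwa [this]
  · rw [Fr_of_not_isNonzeroSquare hy hr, neg_zero] at h
    exact hb0 h.symm

/-- The case `a = 1` and `b / 2` a square. Both coordinates `x`, `x + 1` are then nonzero squares;
at most one solution has `y` outside the nonzero squares, at most one has `y + 1` outside them,
and `D₀₀ ≤ 1` rules out all others. -/
theorem boomerangCount_one_le (hq : Fintype.card F % 4 = 3) {r : ℕ} (hr : 1 ≤ r)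
    (hD : ∀ b : F, b ≠ 0 → D r 0 0 b ≤ 1) (hg : Nat.gcd r (Fintype.card F - 1) ∣ 2) {b : F}
    (hb : IsNonzeroSquare (b / 2)) : boomerangCount (Fr r) 1 b ≤ 2 := by
  classical
  have h2 := two_ne_zero_of_card hq
  have hb0 : b ≠ 0 := (div_ne_zero_iff.1 hb.1).1
  have inj : ∀ {x y : F}, IsNonzeroSquare x → IsNonzeroSquare y → Fr r x = Fr r y → x = y := by
    intro x y hx hy h
    rw [Fr_of_isNonzeroSquare hx, Fr_of_isNonzeroSquare hy] at h
    exact hx.pow_inj hq hg hy (mul_left_cancel₀ h2 h)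
  have zero : ∀ {x : F}, ¬ IsNonzeroSquare x → Fr r x = 0 :=
    fun hx => Fr_of_not_isNonzeroSquare hx hr
  set T := (Finset.univ : Finset (F × F)).filter
    (fun z => Fr r z.1 - Fr r z.2 = b ∧ Fr r (z.1 + 1) - Fr r (z.2 + 1) = b) with hT
  have mem : ∀ {x y : F}, (x, y) ∈ T → Fr r x - Fr r y = b ∧ Fr r (x + 1) - Fr r (y + 1) = b ∧
      IsNonzeroSquare x ∧ IsNonzeroSquare (x + 1) := by
    intro x y h
    simp only [hT, Finset.mem_filter, Finset.mem_univ, true_and] at h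
    exact ⟨h.1, h.2, isNonzeroSquare_of_sub_eq hq hr hb h.1, isNonzeroSquare_of_sub_eq hq hr hb h.2⟩
  -- `y` and `y + 1` cannot both lie outside the nonzero squares: `x` and `x + 1` would coincide.
  have one : ∀ {x y : F}, (x, y) ∈ T → IsNonzeroSquare y ∨ IsNonzeroSquare (y + 1) := by
    intro x y h
    obtain ⟨e1, e2, hx, hx1⟩ := mem h
    by_contra! hy
    rw [zero hy.1] at e1
    rw [zero hy.2] at e2
    have := inj hx hx1 (by linear_combination e1 - e2)
    simp at this
  have cover : T ⊆ T.filter (fun z => ¬ IsNonzeroSquare z.2) ∪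
      T.filter (fun z => ¬ IsNonzeroSquare (z.2 + 1)) := by
    rintro ⟨x, y⟩ h
    obtain ⟨e1, e2, hx, hx1⟩ := mem h
    simp only [Finset.mem_union, Finset.mem_filter, h, true_and]
    by_contra! hy
    have hxy : Fr r (x + 1) - Fr r x = Fr r (y + 1) - Fr r y := by linear_combination e2 - e1
    have hc : Fr r (x + 1) - Fr r x ≠ 0 := by
      intro h0
      have := inj hx1 hx (sub_eq_zero.1 h0)
      simp at this
    have hle := Finset.card_le_one.1 (hD _ hc)
    have : x = y := hle x (by simp [mem_S_zero_zero, hx, hx1]) y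
      (by simp [mem_S_zero_zero, hy.1, hy.2, hxy])
    rw [this, sub_self] at e1
    exact hb0 e1.symm
  have c1 : (T.filter (fun z => ¬ IsNonzeroSquare z.2)).card ≤ 1 := by
    rw [Finset.card_le_one]
    rintro ⟨x, y⟩ h ⟨x', y'⟩ h'
    obtain ⟨h, hy⟩ := Finset.mem_filter.1 h
    obtain ⟨h', hy'⟩ := Finset.mem_filter.1 h'
    obtain ⟨e1, e2, hx, hx1⟩ := mem h
    obtain ⟨e1', e2', hx', hx1'⟩ := mem h'
    rw [zero hy] at e1
    rw [zero hy'] at e1'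
    obtain rfl : x = x' := inj hx hx' (by linear_combination e1 - e1')
    have := inj ((one h).resolve_left hy) ((one h').resolve_left hy')
      (by linear_combination e2' - e2)
    rw [add_right_cancel this]
  have c2 : (T.filter (fun z => ¬ IsNonzeroSquare (z.2 + 1))).card ≤ 1 := by
    rw [Finset.card_le_one]
    rintro ⟨x, y⟩ h ⟨x', y'⟩ h'
    obtain ⟨h, hy⟩ := Finset.mem_filter.1 h
    obtain ⟨h', hy'⟩ := Finset.mem_filter.1 h'
    obtain ⟨e1, e2, hx, hx1⟩ := mem h
    obtain ⟨e1', e2', hx', hx1'⟩ := mem h'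
    rw [zero hy] at e2
    rw [zero hy'] at e2'
    obtain rfl : x = x' := add_right_cancel (inj hx1 hx1' (by linear_combination e2 - e2'))
    rw [inj ((one h).resolve_right hy) ((one h').resolve_right hy')
      (by linear_combination e1' - e1)]
  calc T.card ≤ _ := Finset.card_le_card cover
    _ ≤ _ := Finset.card_union_le _ _
    _ ≤ 2 := by omega

/-- Scaling by a nonzero square, exchanging `(x, y)` with `(x + a, y + a)`, and swapping `x` and
`y` reduce all pairs `(a, b)` to `a = 1` and `b / 2` a square. -/
theorem boomerangUniformity_Fr_le_two (hq : Fintype.card F % 4 = 3) {r : ℕ} (hr : 1 ≤ r)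
    (hD : ∀ b : F, b ≠ 0 → D r 0 0 b ≤ 1) (hg : Nat.gcd r (Fintype.card F - 1) ∣ 2) :
    boomerangUniformity (Fr r : F → F) ≤ 2 := by
  have h2 := two_ne_zero_of_card hq
  have step1 : ∀ b : F, b ≠ 0 → boomerangCount (Fr r) 1 b ≤ 2 := by
    intro b hb
    rcases isNonzeroSquare_or_neg hq (div_ne_zero hb h2) with h | h
    · exact boomerangCount_one_le hq hr hD hg h
    · rw [← neg_div] at h
      refine le_trans ?_ (boomerangCount_one_le hq hr hD hg h)
      refine boomerangCount_le_of_injective Prod.swap Prod.swap_injective fun x y e1 e2 => ?_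
      exact ⟨by simp [← e1], by simp [← e2]⟩
  have step2 : ∀ a b : F, IsNonzeroSquare a → b ≠ 0 → boomerangCount (Fr r) a b ≤ 2 := by
    intro a b ha hb
    refine le_trans ?_ (step1 (a⁻¹ ^ r * b) (mul_ne_zero (ha.inv.pow r).1 hb))
    refine boomerangCount_le_of_injective (fun z => (a⁻¹ * z.1, a⁻¹ * z.2)) ?_ fun x y e1 e2 => ?_
    · rintro ⟨x, y⟩ ⟨x', y'⟩ h
      simpa [ha.1] using h
    · have key : ∀ x : F, a⁻¹ * x + 1 = a⁻¹ * (x + a) := fun x => by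
        rw [mul_add, inv_mul_cancel₀ ha.1]
      simp only [key, Fr_mul ha.inv]
      exact ⟨by rw [← e1]; ring, by rw [← e2]; ring⟩
  refine Finset.sup_le ?_
  rintro ⟨a, b⟩ h
  simp only [Finset.mem_filter, Finset.mem_univ, true_and] at h
  rcases isNonzeroSquare_or_neg hq h.1 with ha | ha
  · exact step2 a b ha h.2
  · refine le_trans ?_ (step2 (-a) b ha h.2)
    refine boomerangCount_le_of_injective (fun z => (z.1 + a, z.2 + a)) ?_ fun x y e1 e2 => ?_
    · rintro ⟨x, y⟩ ⟨x', y'⟩ h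
      simpa using h
    · simpa using ⟨e2, e1⟩

/-- The form in which the hypothesis on `D₀₀` is verified for each exponent. -/
theorem D_zero_zero_le_one (hq : Fintype.card F % 4 = 3) {r : ℕ}
    (h : ∀ x y : F, IsNonzeroSquare x → IsNonzeroSquare (x + 1) → IsNonzeroSquare y →
      IsNonzeroSquare (y + 1) → (x + 1) ^ r - x ^ r = (y + 1) ^ r - y ^ r → x = y) (b : F) :
    D r 0 0 b ≤ 1 := by
  rw [D, Finset.card_le_one]
  intro x hx y hy
  simp only [Finset.mem_filter, mem_S_zero_zero] at hx hy
  obtain ⟨⟨hx, hx1⟩, ex⟩ := hx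
  obtain ⟨⟨hy, hy1⟩, ey⟩ := hy
  apply h x y hx hx1 hy hy1
  rw [Fr_of_isNonzeroSquare hx, Fr_of_isNonzeroSquare hx1] at ex
  rw [Fr_of_isNonzeroSquare hy, Fr_of_isNonzeroSquare hy1] at ey
  exact mul_left_cancel₀ (two_ne_zero_of_card hq) (by linear_combination ex - ey)

end Uniformity

/-! ### Greatest common divisors -/

/-- Modulo a common divisor, `p ^ k ≡ -1` and `p ^ n ≡ 1`, so that
`-1 = (-1) ^ n ≡ p ^ (k n) ≡ 1`. -/
theorem gcd_pow_succ_dvd_two {p n k : ℕ} (hn : Odd n) :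
    Nat.gcd (p ^ k + 1) (p ^ n - 1) ∣ 2 := by
  rcases Nat.eq_zero_or_pos p with rfl | hp
  · rcases Nat.eq_zero_or_pos k with rfl | hk
    · exact (Nat.gcd_dvd_left _ _).trans (by norm_num)
    · rw [zero_pow hk.ne', zero_add, Nat.gcd_one_left]
      exact one_dvd 2
  set d := Nat.gcd (p ^ k + 1) (p ^ n - 1)
  have h1 : (p : ℤ) ^ k ≡ -1 [ZMOD d] := by
    have : (d : ℤ) ∣ ((p ^ k + 1 : ℕ) : ℤ) := Int.natCast_dvd_natCast.2 (Nat.gcd_dvd_left _ _)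
    push_cast at this
    exact (Int.modEq_iff_dvd.2 (by simpa using this)).symm
  have h2 : (p : ℤ) ^ n ≡ 1 [ZMOD d] := by
    have : (d : ℤ) ∣ ((p ^ n - 1 : ℕ) : ℤ) := Int.natCast_dvd_natCast.2 (Nat.gcd_dvd_right _ _)
    rw [Nat.cast_sub (Nat.one_le_pow _ _ hp)] at this
    push_cast at this
    exact (Int.modEq_iff_dvd.2 this).symm
  have h3 := h1.pow n
  have h4 := h2.pow k
  rw [← pow_mul, hn.neg_one_pow] at h3
  rw [← pow_mul, one_pow, mul_comm] at h4
  have := (h3.symm.trans h4).dvd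
  norm_num at this
  exact_mod_cast this

/-- A common divisor `d` of `Q - 1` and `q - 1`, where `Q = 3 ^ m` and `Q ^ 2 = 3 q`, satisfies
`1 ≡ Q ^ 2 = 3 q ≡ 3` modulo `d`. -/
theorem gcd_sub_one_dvd_two {Q q : ℕ} (hQ : 1 ≤ Q) (hq : 1 ≤ q) (h : Q ^ 2 = 3 * q) :
    Nat.gcd (Q - 1) (q - 1) ∣ 2 := by
  obtain ⟨Q, rfl⟩ := Nat.exists_eq_add_of_le' hQ
  obtain ⟨q, rfl⟩ := Nat.exists_eq_add_of_le' hq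
  simp only [Nat.add_sub_cancel]
  have h1 : Nat.gcd Q q ∣ Q * (Q + 2) := (Nat.gcd_dvd_left _ _).mul_right _
  have h2 : Nat.gcd Q q ∣ 3 * q := (Nat.gcd_dvd_right _ _).mul_left _
  have h3 : Q * (Q + 2) = 3 * q + 2 := by linarith
  rw [h3] at h1
  exact (Nat.dvd_add_right h2).1 h1

/-! ### Injectivity of the difference for the listed exponents -/

section Exponents

variable {F : Type*} [Field F]

theorem eq_or_mul_eq_one_of_add_inv_eq {s t : F} (hs : s ≠ 0) (ht : t ≠ 0)
    (h : s + s⁻¹ = t + t⁻¹) : s = t ∨ s * t = 1 := by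
  have : (s - t) * (s * t - 1) = 0 := by
    field_simp at h
    linear_combination h
  rcases mul_eq_zero.1 this with h | h
  · exact Or.inl (sub_eq_zero.1 h)
  · exact Or.inr (sub_eq_zero.1 h)

theorem sq_add_inv_eq {s t : F} (h : s ^ 2 = t ^ 2 ∨ (s * t) ^ 2 = 1) :
    s ^ 2 + (s ^ 2)⁻¹ = t ^ 2 + (t ^ 2)⁻¹ := by
  rcases h with h | h
  · rw [h]
  · rw [mul_pow] at h
    rw [eq_inv_of_mul_eq_one_left h, inv_inv, add_comm]

/-- In characteristic `3` the conic `y ^ 2 - z ^ 2 = 1` is parametrized by `y = t + t⁻¹`,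
`z = t - t⁻¹`, up to the signs of `y` and `z`. -/
theorem exists_param_of_isSquare (h3 : (3 : F) = 0) {x : F} (hx : IsSquare x)
    (hx1 : IsSquare (x + 1)) :
    ∃ t : F, t ≠ 0 ∧ x = (t - t⁻¹) ^ 2 ∧ x + 1 = (t + t⁻¹) ^ 2 := by
  obtain ⟨z, hz⟩ := hx
  obtain ⟨y, hy⟩ := hx1
  have h1 : (y + z) * (y - z) = 1 := by linear_combination hz - hy
  have ht : y + z ≠ 0 := left_ne_zero_of_mul_eq_one h1
  have hi : (y + z)⁻¹ = y - z := (eq_inv_of_mul_eq_one_right h1).symm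
  refine ⟨y + z, ht, ?_, ?_⟩
  · rw [hi]; linear_combination hz - z ^ 2 * h3
  · rw [hi]; linear_combination hy - y ^ 2 * h3

theorem sub_inv_sq (h3 : (3 : F) = 0) {t : F} (ht : t ≠ 0) :
    (t - t⁻¹) ^ 2 = t ^ 2 + (t ^ 2)⁻¹ + 1 := by
  field_simp
  linear_combination -t ^ 2 * h3

/-- The parameter `t` of `x` enters through `ρ = t ^ (Q - 1)`, where `Q = 3 ^ m` and `φ` is the
`Q`-power map; it satisfies `ρ * φ ρ = t ^ 2`, so that `ρ` determines `x`. -/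
theorem exists_param_half_pow_sub_one [CharP F 3] {m r : ℕ} (hr : 2 * r + 1 = 3 ^ m)
    (φ : F →+* F) (hφ : ∀ a, φ a = a ^ 3 ^ m) (hφφ : ∀ a, φ (φ a) = a ^ 3) {x : F}
    (hx : IsNonzeroSquare x) (hx1 : IsNonzeroSquare (x + 1)) :
    ∃ ρ : F, ρ ≠ 0 ∧ ρ - ρ⁻¹ ≠ 0 ∧ x = ρ * φ ρ + (ρ * φ ρ)⁻¹ + 1 ∧
      ((x + 1) ^ r - x ^ r) * ((ρ + ρ⁻¹) * φ (ρ - ρ⁻¹) + (ρ - ρ⁻¹) * φ (ρ + ρ⁻¹)) =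
        -(ρ - ρ⁻¹) := by
  have h3 : (3 : F) = 0 := CharP.cast_eq_zero F 3
  obtain ⟨t, ht, e1, e2⟩ := exists_param_of_isSquare h3 hx.2 hx1.2
  have hT : φ t ≠ 0 := by simpa using ht
  have hρσ : φ t / t * φ (φ t / t) = t ^ 2 := by
    rw [map_div₀, hφφ]; field_simp
  have hσ : φ (φ t / t) = t ^ 3 / φ t := by rw [map_div₀, hφφ]
  have hsum : (φ t / t + (φ t / t)⁻¹) * φ (φ t / t - (φ t / t)⁻¹)
      + (φ t / t - (φ t / t)⁻¹) * φ (φ t / t + (φ t / t)⁻¹) = -((t - t⁻¹) * (t + t⁻¹)) := by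
    rw [map_sub, map_add, map_inv₀, hσ]
    field_simp
    linear_combination (t ^ 4 - 1) * (φ t ^ 2 * t ^ 2) * h3
  have hz : t - t⁻¹ ≠ 0 := fun h => hx.1 (by rw [e1, h]; simp)
  have hy : t + t⁻¹ ≠ 0 := fun h => hx1.1 (by rw [e2, h]; simp)
  have hxr : x ^ r * (t - t⁻¹) = φ t - (φ t)⁻¹ := by
    rw [e1, ← pow_mul, ← pow_succ, hr, ← hφ, map_sub, map_inv₀]
  have hx1r : (x + 1) ^ r * (t + t⁻¹) = φ t + (φ t)⁻¹ := by
    rw [e2, ← pow_mul, ← pow_succ, hr, ← hφ, map_add, map_inv₀]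
  refine ⟨φ t / t, div_ne_zero hT ht, ?_, ?_, ?_⟩
  · intro h
    rw [h, map_zero, mul_zero, zero_mul, add_zero] at hsum
    exact neg_ne_zero.2 (mul_ne_zero hz hy) hsum.symm
  · rw [hρσ, e1, sub_inv_sq h3 ht]
  · have : (φ t + (φ t)⁻¹) * (t - t⁻¹) - (φ t - (φ t)⁻¹) * (t + t⁻¹) = φ t / t - (φ t / t)⁻¹ := by
      field_simp
      linear_combination (t ^ 2 - φ t ^ 2) * h3
    rw [hsum, ← this]
    linear_combination -(t - t⁻¹) * hx1r + (t + t⁻¹) * hxr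

variable [Fintype F]

/-- The map `x ↦ x ^ (p ^ k) + x` is injective, because its kernel would require `-1` to be the
even power `x ^ (p ^ k - 1)`. -/
theorem eq_of_pow_char_add_one_diff {p k r : ℕ} [Fact p.Prime] [CharP F p] (hp : Odd p)
    (hq : Fintype.card F % 4 = 3) (hr : r = p ^ k + 1) {x y : F}
    (h : (x + 1) ^ r - x ^ r = (y + 1) ^ r - y ^ r) : x = y := by
  by_contra hne
  have hd : x - y ≠ 0 := sub_ne_zero.2 hne
  have h1 : (x - y) ^ p ^ k = -(x - y) := by
    rw [sub_pow_char_pow]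
    simp only [hr, pow_succ, add_pow_char_pow, one_pow] at h
    linear_combination h
  obtain ⟨m, hm⟩ := hp.pow (n := k)
  rw [hm, pow_succ, pow_mul'] at h1
  apply not_isSquare_neg_one hq
  refine ⟨(x - y) ^ m, mul_right_cancel₀ hd ?_⟩
  linear_combination -h1

/-- With `x = (t - t⁻¹) ^ 2` and `x + 1 = (t + t⁻¹) ^ 2`, the difference `(x + 1) ^ r - x ^ r` is
`-(w + w⁻¹)` for `w = t ^ (3 ^ k - 1)`, and `w` determines `t` up to sign since
`gcd (3 ^ k - 1, 3 ^ n - 1) = 2`. -/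
theorem eq_of_half_pow_add_one_diff {n k r : ℕ} [CharP F 3] (hcard : Fintype.card F = 3 ^ n)
    (hk : Nat.gcd k n = 1) (hr : 2 * r = 3 ^ k + 1) {x y : F} (hx : IsSquare x)
    (hx1 : IsSquare (x + 1)) (hy : IsSquare y) (hy1 : IsSquare (y + 1))
    (h : (x + 1) ^ r - x ^ r = (y + 1) ^ r - y ^ r) : x = y := by
  have : Fact (Nat.Prime 3) := ⟨Nat.prime_three⟩
  have h3 : (3 : F) = 0 := CharP.cast_eq_zero F 3
  obtain ⟨t, ht, e1, e2⟩ := exists_param_of_isSquare h3 hx hx1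
  obtain ⟨s, hs, e3, e4⟩ := exists_param_of_isSquare h3 hy hy1
  have hk1 : 3 ^ k = 3 ^ k - 1 + 1 := (Nat.sub_add_cancel (Nat.one_le_pow _ _ (by norm_num))).symm
  have diff : ∀ u : F, u ≠ 0 → ((u + u⁻¹) ^ 2) ^ r - ((u - u⁻¹) ^ 2) ^ r =
      -(u ^ (3 ^ k - 1) + (u ^ (3 ^ k - 1))⁻¹) := by
    intro u hu
    have hpow : u ^ 3 ^ k = u ^ (3 ^ k - 1) * u := by rw [← pow_succ, ← hk1]
    rw [← pow_mul, ← pow_mul, hr, pow_succ, pow_succ, add_pow_char_pow, sub_pow_char_pow, inv_pow,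
      hpow]
    have hu' : u ^ (3 ^ k - 1) ≠ 0 := pow_ne_zero _ hu
    field_simp
    linear_combination ((u ^ (3 ^ k - 1)) ^ 2 + 1) * u ^ 2 * h3
  have root : ∀ w : F, w ≠ 0 → w ^ (3 ^ k - 1) = 1 → w ^ 2 = 1 := by
    intro w hw h
    have h' : w ^ (3 ^ n - 1) = 1 := by
      rw [← hcard]; exact FiniteField.pow_card_sub_one_eq_one w hw
    have := Nat.dvd_gcd (orderOf_dvd_of_pow_eq_one h) (orderOf_dvd_of_pow_eq_one h')
    rw [Nat.pow_sub_one_gcd_pow_sub_one, hk] at this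
    exact orderOf_dvd_iff_pow_eq_one.1 this
  rw [e2, e1, e4, e3, diff t ht, diff s hs, neg_inj] at h
  rw [e1, e3, sub_inv_sq h3 ht, sub_inv_sq h3 hs]
  congr 1
  refine sq_add_inv_eq ?_
  rcases eq_or_mul_eq_one_of_add_inv_eq (pow_ne_zero _ ht) (pow_ne_zero _ hs) h with h | h
  · left
    have := root (t / s) (div_ne_zero ht hs) (by rw [div_pow, h, div_self (pow_ne_zero _ hs)])
    rwa [div_pow, div_eq_one_iff_eq (pow_ne_zero 2 hs)] at this
  · right
    exact root (t * s) (mul_ne_zero ht hs) (by rw [mul_pow, h])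

/-- Two solutions `x ≠ y` satisfy `y = -(x + 1)`, which is not a square. -/
theorem eq_of_cube_diff (hq : Fintype.card F % 4 = 3) (h3 : (3 : F) ≠ 0) {x y : F}
    (hx1 : IsNonzeroSquare (x + 1)) (hy : IsNonzeroSquare y)
    (h : (x + 1) ^ 3 - x ^ 3 = (y + 1) ^ 3 - y ^ 3) : x = y := by
  have : 3 * ((x - y) * (x + 1 + y)) = 0 := by linear_combination h
  rcases mul_eq_zero.1 ((mul_eq_zero.1 this).resolve_left h3) with h | h
  · exact sub_eq_zero.1 h
  · exact absurd (eq_neg_of_add_eq_zero_right h ▸ hy) (hx1.not_neg hq)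

/-- Here `x ↦ x ^ r` inverts `x ↦ x ^ 3`. With `u = (x + 1) ^ r`, `v = x ^ r` and `b = u - v`, the
equation `u ^ 3 - v ^ 3 = 1` is quadratic in `v`, with roots `v` and `-u`; the latter is not a
square. -/
theorem eq_of_cube_root_diff (hq : Fintype.card F % 4 = 3) (h3 : (3 : F) ≠ 0) {r : ℕ}
    (hr : 3 * r = 2 * Fintype.card F - 1) {x y : F} (hx1 : IsNonzeroSquare (x + 1))
    (hy : IsNonzeroSquare y) (h : (x + 1) ^ r - x ^ r = (y + 1) ^ r - y ^ r) : x = y := by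
  have cube : ∀ a : F, (a ^ r) ^ 3 = a := by
    intro a
    have : 2 * Fintype.card F - 1 = Fintype.card F - 1 + Fintype.card F := by omega
    rw [← pow_mul, mul_comm, hr, this, pow_add, FiniteField.pow_card, ← pow_succ,
      Nat.sub_add_cancel (by omega), FiniteField.pow_card]
  have c1 := cube (x + 1)
  have c2 := cube x
  have c3 := cube (y + 1)
  have c4 := cube y
  obtain ⟨b, hb⟩ : ∃ b, b = (x + 1) ^ r - x ^ r := ⟨_, rfl⟩
  have hu : (x + 1) ^ r = x ^ r + b := by rw [hb]; ring
  have hu' : (y + 1) ^ r = y ^ r + b := by rw [hb, h]; ring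
  have hb0 : b ≠ 0 := by
    rintro rfl
    rw [hu, add_zero, c2] at c1
    simp at c1
  rw [hu] at c1
  rw [hu'] at c3
  have : 3 * b * ((x ^ r - y ^ r) * (x ^ r + b + y ^ r)) = 0 := by
    linear_combination c1 - c2 - c3 + c4
  rcases mul_eq_zero.1 ((mul_eq_zero.1 this).resolve_left (mul_ne_zero h3 hb0)) with h | h
  · rw [← c2, ← c4, sub_eq_zero.1 h]
  · rw [← hu] at h
    exact absurd (eq_neg_of_add_eq_zero_right h ▸ hy.pow r) ((hx1.pow r).not_neg hq)

/-- On squares `x ↦ x ^ r` inverts `x ↦ x ^ 4`. With `u = (x + 1) ^ r`, `v = x ^ r` and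
`b = u - v`, the sum `s = u + v` satisfies `s ^ 3 + b ^ 2 * s = -b⁻¹`, and two different solutions
would make `-1` a square. -/
theorem eq_of_fourth_root_diff (hq : Fintype.card F % 4 = 3) (h3 : (3 : F) = 0) {r : ℕ}
    (hr : 8 * r = 3 * Fintype.card F - 1) {x y : F} (hx : IsSquare x) (hx1 : IsSquare (x + 1))
    (hy : IsSquare y) (hy1 : IsSquare (y + 1))
    (h : (x + 1) ^ r - x ^ r = (y + 1) ^ r - y ^ r) : x = y := by
  have fourth : ∀ a : F, IsSquare a → (a ^ r) ^ 4 = a := by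
    rintro a ⟨z, rfl⟩
    have : 3 * Fintype.card F - 1 =
      Fintype.card F + Fintype.card F + (Fintype.card F - 1) := by omega
    have e : (z * z) ^ (r * 4) = z ^ (8 * r) := by rw [← sq, ← pow_mul]; congr 1; ring
    by_cases hz : z = 0
    · have : r ≠ 0 := by omega
      simp [hz, this]
    · rw [← pow_mul, e, hr, this, pow_add, pow_add, FiniteField.pow_card,
        FiniteField.pow_card_sub_one_eq_one z hz, mul_one]
  have c1 := fourth _ hx1
  have c2 := fourth _ hx
  have c3 := fourth _ hy1
  have c4 := fourth _ hy
  obtain ⟨b, hb⟩ : ∃ b, b = (x + 1) ^ r - x ^ r := ⟨_, rfl⟩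
  have hu : (x + 1) ^ r = x ^ r + b := by rw [hb]; ring
  have hu' : (y + 1) ^ r = y ^ r + b := by rw [hb, h]; ring
  have hb0 : b ≠ 0 := by
    rintro rfl
    rw [hu, add_zero, c2] at c1
    simp at c1
  rw [hu] at c1
  rw [hu'] at c3
  obtain ⟨d, hd⟩ : ∃ d, d = x ^ r - y ^ r := ⟨_, rfl⟩
  have hx' : x ^ r = y ^ r + d := by rw [hd]; ring
  have hd2 : b * (d * (d ^ 2 + b ^ 2)) = 0 := by
    rw [hx'] at c1 c2
    linear_combination c1 - c2 - c3 + c4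
      - (b * (4 * (y ^ r) ^ 2 * d + 4 * y ^ r * d ^ 2 + d ^ 3)
        + 2 * b ^ 2 * (2 * y ^ r * d + d ^ 2) + b ^ 3 * d) * h3
  rcases mul_eq_zero.1 ((mul_eq_zero.1 hd2).resolve_left hb0) with h | h
  · rw [← c2, ← c4, hx', h, add_zero]
  · exfalso
    apply not_isSquare_neg_one hq
    refine ⟨d / b, ?_⟩
    field_simp
    linear_combination -h

/-- Here `Q ^ 2 = 3 q`, so that the `Q`-power map applied twice is cubing, and
`eq_of_conic_equation` applies to the parameter `ρ` of `x`. -/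
theorem eq_of_half_pow_sub_one_diff {n r : ℕ} [CharP F 3] (hcard : Fintype.card F = 3 ^ n)
    (hn : Odd n) (hr : 2 * r = 3 ^ ((n + 1) / 2) - 1) {x y : F} (hx : IsNonzeroSquare x)
    (hx1 : IsNonzeroSquare (x + 1)) (hy : IsNonzeroSquare y) (hy1 : IsNonzeroSquare (y + 1))
    (h : (x + 1) ^ r - x ^ r = (y + 1) ^ r - y ^ r) : x = y := by
  have : Fact (Nat.Prime 3) := ⟨Nat.prime_three⟩
  have h3 : (3 : F) = 0 := CharP.cast_eq_zero F 3
  set m := (n + 1) / 2 with hm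
  have hmn : m + m = n + 1 := by obtain ⟨j, rfl⟩ := hn; omega
  have hQ : 2 * r + 1 = 3 ^ m := by
    rw [hr, Nat.sub_add_cancel (Nat.one_le_pow _ _ (by norm_num))]
  let φ : F →+* F := iterateFrobenius F 3 m
  have hφ : ∀ a, φ a = a ^ 3 ^ m := fun a => iterateFrobenius_def 3 m a
  have hφφ : ∀ a, φ (φ a) = a ^ 3 := by
    intro a
    rw [hφ, hφ, ← pow_mul, ← pow_add, hmn, pow_succ, pow_mul, ← hcard, FiniteField.pow_card]
  obtain ⟨ρ, hρ, hM, ex, eb⟩ := exists_param_half_pow_sub_one hQ φ hφ hφφ hx hx1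
  obtain ⟨τ, hτ, hN, ey, eb'⟩ := exists_param_half_pow_sub_one hQ φ hφ hφφ hy hy1
  rw [← h] at eb'
  obtain ⟨b, hb⟩ : ∃ b, b = (x + 1) ^ r - x ^ r := ⟨_, rfl⟩
  rw [← hb] at eb eb'
  have hb0 : b ≠ 0 := by
    rintro rfl
    rw [zero_mul] at eb
    exact neg_ne_zero.2 hM eb.symm
  have conic : ∀ u : F, u ≠ 0 → (u + u⁻¹) ^ 2 - (u - u⁻¹) ^ 2 = 1 := by
    intro u hu
    field_simp
    linear_combination u ^ 2 * h3
  have solve : ∀ X M : F, b * X = -M → -b⁻¹ * M = X := by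
    intro X M h
    field_simp
    linear_combination -h
  have hP := eq_of_conic_equation h3 φ hφφ (B := -b⁻¹) (neg_ne_zero.2 (inv_ne_zero hb0)) hM hN
    (conic ρ hρ) (conic τ hτ)
    (solve _ _ eb) (solve _ _ eb')
  rw [ex, ey]
  rcases eq_or_mul_eq_one_of_add_inv_eq hρ hτ hP with h | h
  · rw [h]
  · rw [eq_inv_of_mul_eq_one_left h, map_inv₀, ← mul_inv, inv_inv, add_comm (_)⁻¹]

end Exponents

end Boomerang

/-! ### The bound for arbitrary and for listed exponents -/

theorem mainTheorem2 {F : Type*} [Field F] [Fintype F] [DecidableEq F]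
    (p n : ℕ) (hp : p.Prime) (hcard : Fintype.card F = p ^ n) (hq : p ^ n % 4 = 3) :
    (∀ r : ℕ, 1 ≤ r →
      (∀ b : F, b ≠ 0 → Boomerang.D r 0 0 b ≤ 1) →
      Nat.gcd r (p ^ n - 1) ∣ 2 →
      Boomerang.boomerangUniformity (Boomerang.Fr r : F → F) ≤ 2) ∧
    (∀ r : ℕ, Boomerang.IsListedExponent p n r →
      Boomerang.boomerangUniformity (Boomerang.Fr r : F → F) ≤ 2) := by
  have : Fact p.Prime := ⟨hp⟩
  have : CharP F p := charP_of_card_eq_prime_pow hcard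
  have hq' : Fintype.card F % 4 = 3 := hcard ▸ hq
  have part1 : ∀ r : ℕ, 1 ≤ r → (∀ b : F, b ≠ 0 → Boomerang.D r 0 0 b ≤ 1) →
      Nat.gcd r (p ^ n - 1) ∣ 2 → Boomerang.boomerangUniformity (Boomerang.Fr r : F → F) ≤ 2 :=
    fun r hr hD hg => Boomerang.boomerangUniformity_Fr_le_two hq' hr hD (hcard ▸ hg)
  refine ⟨part1, fun r hlist => ?_⟩
  have reduce : 1 ≤ r → Nat.gcd r (p ^ n - 1) ∣ 2 →
      (∀ x y : F, Boomerang.IsNonzeroSquare x → Boomerang.IsNonzeroSquare (x + 1) →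
        Boomerang.IsNonzeroSquare y → Boomerang.IsNonzeroSquare (y + 1) →
        (x + 1) ^ r - x ^ r = (y + 1) ^ r - y ^ r → x = y) →
      Boomerang.boomerangUniformity (Boomerang.Fr r : F → F) ≤ 2 :=
    fun hr hg h => part1 r hr (fun b _ => Boomerang.D_zero_zero_le_one hq' h b) hg
  have hn0 : n ≠ 0 := by rintro rfl; simp at hq
  have three_ne : p ^ n % 12 = 11 → (3 : F) ≠ 0 := by
    intro h h3
    have hdvd : p ∣ 3 := (CharP.cast_eq_zero_iff F p 3).1 (by exact_mod_cast h3)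
    obtain rfl := (Nat.prime_dvd_prime_iff_eq hp Nat.prime_three).1 hdvd
    have := dvd_pow_self 3 hn0
    omega
  have gcd_right : Nat.gcd r (p ^ n - 1) ∣ p ^ n - 1 := Nat.gcd_dvd_right _ _
  rcases hlist with ⟨hn, k, hr⟩ | ⟨rfl, hn, k, hk, hr⟩ | ⟨h12, hr⟩ | ⟨h12, hr⟩ | ⟨rfl, hn, hr⟩ |
    ⟨rfl, hn, hr⟩
  · have hodd : Odd p := by
      refine hp.odd_of_ne_two ?_
      rintro rfl
      have := dvd_pow_self 2 hn0
      omega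
    exact reduce (by omega) (hr ▸ Boomerang.gcd_pow_succ_dvd_two hn)
      fun x y _ _ _ _ h => Boomerang.eq_of_pow_char_add_one_diff hodd hq' hr h
  · refine reduce (by have := Nat.one_le_pow k 3 (by norm_num); omega) ?_
      fun x y hx hx1 hy hy1 h =>
        Boomerang.eq_of_half_pow_add_one_diff hcard hk hr hx.2 hx1.2 hy.2 hy1.2 h
    exact (Nat.gcd_dvd_gcd_of_dvd_left _ (Dvd.intro_left 2 hr)).trans
      (Boomerang.gcd_pow_succ_dvd_two hn)
  · subst hr
    refine reduce (by norm_num) ?_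
      fun x y _ hx1 hy _ h => Boomerang.eq_of_cube_diff hq' (three_ne h12) hx1 hy h
    have h1 : Nat.gcd 3 (p ^ n - 1) ∣ 3 * (p ^ n / 3) := (Nat.gcd_dvd_left _ _).mul_right _
    have h2 : p ^ n - 1 = 3 * (p ^ n / 3) + 1 := by omega
    exact ((Nat.dvd_add_right h1).1 (h2 ▸ gcd_right)).trans (one_dvd 2)
  · refine reduce (by omega) ?_
      fun x y _ hx1 hy _ h =>
        Boomerang.eq_of_cube_root_diff hq' (three_ne h12) (hcard ▸ hr) hx1 hy h
    have h1 : Nat.gcd r (p ^ n - 1) ∣ 3 * r := (Nat.gcd_dvd_left _ _).mul_left _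
    have h2 : 3 * r = 2 * (p ^ n - 1) + 1 := by omega
    rw [h2] at h1
    exact ((Nat.dvd_add_right (gcd_right.mul_left 2)).1 h1).trans (one_dvd 2)
  · have hm : 3 ≤ 3 ^ ((n + 1) / 2) := by
      have : 0 < (n + 1) / 2 := by omega
      exact Nat.le_self_pow this.ne' 3
    refine reduce (by omega) ?_
      fun x y hx hx1 hy hy1 h => Boomerang.eq_of_half_pow_sub_one_diff hcard hn hr hx hx1 hy hy1 h
    refine (Nat.gcd_dvd_gcd_of_dvd_left _ (Dvd.intro_left 2 hr)).trans
      (Boomerang.gcd_sub_one_dvd_two (by omega) (Nat.one_le_pow _ _ (by norm_num)) ?_)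
    rw [← pow_mul, ← pow_succ']
    congr 1
    obtain ⟨j, rfl⟩ := hn
    omega
  · rw [pow_succ'] at hr
    refine reduce (by omega) ?_
      fun x y hx hx1 hy hy1 h =>
        Boomerang.eq_of_fourth_root_diff hq' (CharP.cast_eq_zero F 3) (hcard ▸ hr) hx.2 hx1.2 hy.2
          hy1.2 h
    have h1 : Nat.gcd r (3 ^ n - 1) ∣ 8 * r := (Nat.gcd_dvd_left _ _).mul_left _
    have h2 : 8 * r = 3 * (3 ^ n - 1) + 2 := by omega
    rw [h2] at h1
    exact (Nat.dvd_add_right (gcd_right.mul_left 3)).1 h1
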